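/- Let $G$ be a finite acyclic directed graph. For vertices write $a\le b$ if there is a directed path (possibly of length $0$) from $b$ to $a$. An orthogonal pair is a pair $(\mathcal D,\mathcal U)$ of disjoint sets of vertices, each consisting of pairwise non-adjacent vertices, such that there is no edge from an element of $\mathcal D$ to an element of $\mathcal U$. It is tight if it stops being an orthogonal pair whenever a vertex $k\notin\mathcal D$ is put into $\mathcal D$, either as an additional element or in place of one or more elements of $\mathcal D$ that are smaller than $k$, and likewise whenever a vertex $k\notin\mathcal U$ is put into $\mathcal U$, either as an additional element or in place of one or more elements of $\mathcal U$ that are larger than $k$. Let $\mathrm{top}(G)$ be the set of tight orthogonal pairs. Fix a linear extension $\ell$ of the order on the vertices (so that $b$ precedes $a$ whenever there is an edge $a\to b$) and a reverse linear extension $\ell'$. The flip of $(\mathcal D,\mathcal U)\in\mathrm{top}(G)$ at a vertex $g$ is $(\mathcal D,\mathcal U)$ itself if $g\notin\mathcal D\cup\mathcal U$. Otherwise it is the pair $(\mathcal D',\mathcal U')$ computed as follows. Start with $\mathcal D'=\{k\in\mathcal D: k\not\le g\}$ and $\mathcal U'=\{k\in\mathcal U: k\not\ge g\}$, and put $g$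 into $\mathcal D'$ if $g\in\mathcal U$ and into $\mathcal U'$ if $g\in\mathcal D$. Then go through the vertices $k$ in the order $\ell'$ and add $k$ to $\mathcal D'$ if $k\not\ge g$, $k\notin\mathcal U'$, there is no edge from $k$ to the current $\mathcal U'$, and there is no edge from the current $\mathcal D'$ to $k$. Finally go through the vertices $k$ in the order $\ell$ and add $k$ to $\mathcal U'$ if $k\not\le g$, $k\notin\mathcal D'$, there is no edge from $\mathcal D'$ to $k$, and there is no edge from $k$ to the current $\mathcal U'$. Order $\mathrm{top}(G)$ by the reflexive and transitive closure of the relations that relate $(\mathcal D,\mathcal U)$ to its flip at $g$ for each $g\in\mathcal U$. Then $\mathrm{top}(G)$ with this relation is a lattice (in particular, partially ordered) if and only if there is no partition of the vertex set of $G$ as $X_1\sqcup X_2\sqcup X_3\sqcup X_4\sqcup Z$ such that 1. $X_1,X_2,X_3,X_4$ are nonempty ($Z$ may be empty); 2. every element of $X_3$ has an edge from some element of $X_4$ and an edge to some element of $X_2$; 3. every element of $X_2$ has an edge to some element of $X_1$ and an edge from some element of $X_3$; 4. there are no edges from $X_4$ to $X_2$, from $X_4$ to $X_1$, or from $X_3$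 to $X_1$; 5. every element of $Z$ has an edge from some element of $X_4$ and an edge to some element of $X_1$. -/

import Mathlib

namespace IndepPoset

variable {V : Type*}

/-- A directed graph is acyclic if no nonempty directed path returns to its starting vertex. -/
def IsAcyclic (G : Digraph V) : Prop :=
  ∀ v, ¬ Relation.TransGen G.Adj v v

/-- The order on the vertices of `G`: `a ≤ b` if there is a directed path from `b` to `a`. -/
def GLE (G : Digraph V) (a b : V) : Prop :=
  Relation.ReflTransGen G.Adj b a

/-- The strict version of the order on the vertices of `G`. -/
def GLT (G : Digraph V) (a b : V) : Prop :=
  GLE G a b ∧ a ≠ b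

/-- A set of pairwise non-adjacent vertices. -/
def IsIndependent (G : Digraph V) (A : Set V) : Prop :=
  ∀ a ∈ A, ∀ b ∈ A, ¬ G.Adj a b

/-- Orthogonal pairs of (disjoint) independent sets: there is no edge from `D` to `U`. -/
structure IsOrthogonalPair (G : Digraph V) (D U : Set V) : Prop where
  indep_left : IsIndependent G D
  indep_right : IsIndependent G U
  disjoint : Disjoint D U
  no_edge : ∀ d ∈ D, ∀ u ∈ U, ¬ G.Adj d u

/-- Tight orthogonal pairs: the pair stops being orthogonal when a new vertex `k` is put into `D`,
either as an additional element (`S = ∅`) or in place of some elements of `D` (those of `S`)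
that are smaller than `k`; and dually for `U`. -/
structure IsTightPair (G : Digraph V) (D U : Set V) : Prop where
  orthogonal : IsOrthogonalPair G D U
  tight_left : ∀ k, k ∉ D → ∀ S ⊆ D, (∀ s ∈ S, GLT G s k) →
    ¬ IsOrthogonalPair G (insert k (D \ S)) U
  tight_right : ∀ k, k ∉ U → ∀ S ⊆ U, (∀ s ∈ S, GLT G k s) →
    ¬ IsOrthogonalPair G D (insert k (U \ S))

/-- The set `top(G)` of tight orthogonal pairs of `G`. -/
def TightPair (G : Digraph V) : Type _ :=
  {p : Set V × Set V // IsTightPair G p.1 p.2}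

/-- `l` lists all the vertices, each once, in the order of a linear extension: if there is an edge
from `a` to `b`, then `b` precedes `a`. -/
structure IsLinearExtension (G : Digraph V) (l : List V) : Prop where
  nodup : l.Nodup
  mem : ∀ v, v ∈ l
  sorted : l.Pairwise fun a b => ¬ G.Adj a b

/-- `l` lists the vertices in the reverse order of a linear extension. -/
def IsReverseLinearExtension (G : Digraph V) (l : List V) : Prop :=
  IsLinearExtension G l.reverse

/-- Greedily enlarge `D`, going through the list `l`: the vertex `k` is added if `k` is not `≥ g`,
`k` is not in `U`, and there is neither an edge from `k` to `U` nor one from the current set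
to `k`. -/
def greedyDown (G : Digraph V) (g : V) (l : List V) (U D : Set V) : Set V :=
  l.foldl (fun D k => {x | x ∈ D ∨ (x = k ∧ ¬ GLE G g k ∧ k ∉ U ∧
    (∀ i ∈ U, ¬ G.Adj k i) ∧ (∀ i ∈ D, ¬ G.Adj i k))}) D

/-- Greedily enlarge `U`, going through the list `l`: the vertex `k` is added if `k` is not `≤ g`,
`k` is not in `D`, and there is neither an edge from `D` to `k` nor one from `k` to the
current set. -/
def greedyUp (G : Digraph V) (g : V) (l : List V) (D U : Set V) : Set V :=
  l.foldl (fun U k => {x | x ∈ U ∨ (x = k ∧ ¬ GLE G k g ∧ k ∉ D ∧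
    (∀ i ∈ D, ¬ G.Adj i k) ∧ (∀ i ∈ U, ¬ G.Adj k i))}) U

/-- The part of `D` that a flip at `g` keeps, with `g` added if `g` was in `U`. -/
def keepDown (G : Digraph V) (g : V) (D U : Set V) : Set V :=
  {k | (k ∈ D ∧ ¬ GLE G k g) ∨ (k = g ∧ g ∈ U)}

/-- The part of `U` that a flip at `g` keeps, with `g` added if `g` was in `D`. -/
def keepUp (G : Digraph V) (g : V) (D U : Set V) : Set V :=
  {k | (k ∈ U ∧ ¬ GLE G g k) ∨ (k = g ∧ g ∈ D)}

open Classical in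
/-- The flip of the pair `(D, U)` at `g`, computed with the linear extension `l` and the reverse
linear extension `l'`. -/
noncomputable def flip (G : Digraph V) (l l' : List V) (g : V) (p : Set V × Set V) :
    Set V × Set V :=
  if g ∈ p.1 ∨ g ∈ p.2 then
    let D' := greedyDown G g l' (keepUp G g p.1 p.2) (keepDown G g p.1 p.2)
    (D', greedyUp G g l D' (keepUp G g p.1 p.2))
  else p

/-- `q` is obtained from `p` by an upward flip. -/
def UpFlip (G : Digraph V) (l l' : List V) (p q : TightPair G) : Prop :=
  ∃ g ∈ p.1.2, flip G l l' g p.1 = q.1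

/-- The order relation of the independence poset `top(G)`. -/
def IndepLE (G : Digraph V) (l l' : List V) : TightPair G → TightPair G → Prop :=
  Relation.ReflTransGen (UpFlip G l l')

/-- The relation `r` is the order relation of a lattice. -/
def IsLatticeOrder {α : Type*} (r : α → α → Prop) : Prop :=
  ∃ L : Lattice α, ∀ a b : α, L.le a b ↔ r a b

/-- The partitions into five sets that obstruct the lattice property. -/
structure IsFiveSetPartition (G : Digraph V) (X₁ X₂ X₃ X₄ Z : Set V) : Prop where
  disjoint : [X₁, X₂, X₃, X₄, Z].Pairwise Disjoint
  cover : X₁ ∪ X₂ ∪ X₃ ∪ X₄ ∪ Z = Set.univ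
  nonempty₁ : X₁.Nonempty
  nonempty₂ : X₂.Nonempty
  nonempty₃ : X₃.Nonempty
  nonempty₄ : X₄.Nonempty
  edges₃ : ∀ x ∈ X₃, (∃ y ∈ X₄, G.Adj y x) ∧ (∃ y ∈ X₂, G.Adj x y)
  edges₂ : ∀ x ∈ X₂, (∃ y ∈ X₁, G.Adj x y) ∧ (∃ y ∈ X₃, G.Adj y x)
  no_edge₄₂ : ∀ x ∈ X₄, ∀ y ∈ X₂, ¬ G.Adj x y
  no_edge₄₁ : ∀ x ∈ X₄, ∀ y ∈ X₁, ¬ G.Adj x y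
  no_edge₃₁ : ∀ x ∈ X₃, ∀ y ∈ X₁, ¬ G.Adj x y
  edgesZ : ∀ z ∈ Z, (∃ y ∈ X₄, G.Adj y z) ∧ (∃ y ∈ X₁, G.Adj z y)

end IndepPoset

/-! Acyclicity provides a rank on the vertices, and an orthogonal pair is tight exactly when every
vertex outside it has an edge from `D` or an edge to `U`. Hence each component determines the other,
and the flip at `g ∈ U` is the only tight pair with `g` in `D` that changes `D` only below `g` and
`U` only above `g` (`flip_spec`, `IsFlip.unique`). This description is invariant under reversing
edges and swapping components. Upward flips increase `D` lexicographically, so they always generate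
a partial order, in which each flip is a cover (`IsFlip.exists_lex`, `IsFlip.eq_or_eq`). Only joins
and meets are at stake.

Let `j a` and `m b` be the tight pairs with `D = {a}` and `U = {b}`. In a lattice, `j a ≤ m b` holds
only if `a ≠ b` and there is no edge from `a` to `b` (`not_flipLE_of_lattice`). Given a five-set
partition, the joins of `j` over `X₄` and over `X₄ ∪ X₃` differ, yet the first flip between them
would be at a vertex outside `X₄` and `X₁` with no edge from `X₄` and none to `X₁`. No class of the
partition contains such a vertex.

Conversely, maximal pairs of orthogonal sets, not necessarily independent, always form a lattice
under inclusion of first components. A strict inclusion that is not overlapping yields a five-set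
partition (`isOverlapping_of_not_exists`). If there is none, tight pairs correspond to maximal pairs
(`exists_left_eq`), a flip is the closure after adding one vertex (`exists_isFlip_left`), and the
flip order is inclusion (`flipLE_iff_left_subset`). -/

namespace IndepPoset

/-! ### Ranks and the local criterion for tightness. -/

variable {V : Type*} {G : Digraph V}

/-- An injective integer labelling of the vertices that decreases along every edge. -/
structure IsRank (G : Digraph V) (r : V → ℤ) : Prop where
  injective : Function.Injective r
  lt_of_adj : ∀ {a b}, G.Adj a b → r b < r a

namespace IsRank

variable {r : V → ℤ}

theorem le_of_gle (hr : IsRank G r) {a b : V} (h : GLE G a b) : r a ≤ r b := by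
  induction h with
  | refl => exact le_rfl
  | tail _ h ih => exact (hr.lt_of_adj h).le.trans ih

theorem not_gle (hr : IsRank G r) {a b : V} (h : r b < r a) : ¬ GLE G a b :=
  fun h' => (hr.le_of_gle h').not_gt h

theorem not_adj (hr : IsRank G r) {a b : V} (h : r a ≤ r b) : ¬ G.Adj a b :=
  fun h' => (hr.lt_of_adj h').not_ge h

theorem gle_antisymm (hr : IsRank G r) {a b : V} (h : GLE G a b) (h' : GLE G b a) : a = b :=
  hr.injective (le_antisymm (hr.le_of_gle h) (hr.le_of_gle h'))

theorem wellFounded [Finite V] (r : V → ℤ) : WellFounded fun a b => r a < r b :=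
  haveI : IsTrans V fun a b => r a < r b := ⟨fun _ _ _ => lt_trans⟩
  haveI : Std.Irrefl fun a b : V => r a < r b := ⟨fun _ => lt_irrefl _⟩
  Finite.wellFounded_of_trans_of_irrefl _

end IsRank

theorem GLE.of_adj {a b : V} (h : G.Adj b a) : GLE G a b :=
  Relation.ReflTransGen.single h

theorem GLE.trans {a b c : V} (h : GLE G a b) (h' : GLE G b c) : GLE G a c :=
  Relation.ReflTransGen.trans h' h

theorem IsLinearExtension.exists_isRank (hG : IsAcyclic G) {l : List V}
    (hl : IsLinearExtension G l) : ∃ r : V → ℤ, IsRank G r := by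
  classical
  refine ⟨fun v => (l.idxOf v : ℤ), fun a b h => ?_, fun {a b} h => ?_⟩
  · exact (List.idxOf_inj (hl.mem a)).1 (by exact_mod_cast h)
  · by_contra hlt
    have hle : l.idxOf a ≤ l.idxOf b := by exact_mod_cast not_lt.1 hlt
    rcases hle.eq_or_lt with heq | hlt
    · have : a = b := (List.idxOf_inj (hl.mem a)).1 heq
      subst this
      exact hG _ (.single h)
    · have := List.pairwise_iff_getElem.1 hl.sorted _ _ (List.idxOf_lt_length_of_mem (hl.mem a))
        (List.idxOf_lt_length_of_mem (hl.mem b)) hlt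
      simp only [List.getElem_idxOf] at this
      exact this h

/-- An orthogonal pair is tight if and only if every further vertex has an edge from `D` or an edge
to `U`. -/
theorem isTightPair_iff {r : V → ℤ} (hr : IsRank G r) {D U : Set V} :
    IsTightPair G D U ↔ IsOrthogonalPair G D U ∧
      ∀ k, k ∉ D → k ∉ U → (∃ d ∈ D, G.Adj d k) ∨ ∃ u ∈ U, G.Adj k u := by
  constructor
  · refine fun h => ⟨h.orthogonal, fun k hD hU => ?_⟩
    by_contra! hk
    have ho := h.orthogonal
    -- A vertex `k` without an edge from `D` or to `U` can replace its out-neighbours in `D`, which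
    -- are smaller than `k`; the result is still orthogonal.
    refine h.tight_left k hD {s ∈ D | G.Adj k s} (fun s hs => hs.1)
      (fun s hs => ⟨.of_adj hs.2, fun e => hr.not_adj le_rfl (e ▸ hs.2)⟩) ⟨?_, ho.indep_right, ?_, ?_⟩
    · rintro a (rfl | ha) b (rfl | hb)
      · exact hr.not_adj le_rfl
      · exact fun hab => hb.2 ⟨hb.1, hab⟩
      · exact hk.1 a ha.1
      · exact ho.indep_left a ha.1 b hb.1
    · rw [Set.disjoint_left]
      rintro a (rfl | ha) hu
      · exact hU hu
      · exact Set.disjoint_left.1 ho.disjoint ha.1 hu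
    · rintro a (rfl | ha) u hu
      · exact hk.2 u hu
      · exact ho.no_edge a ha.1 u hu
  · rintro ⟨ho, h⟩
    refine ⟨ho, fun k hD S hS hlt hk => ?_, fun k hU S hS hlt hk => ?_⟩
    · have hkU : k ∉ U := fun hu => Set.disjoint_left.1 hk.disjoint (Set.mem_insert _ _) hu
      rcases h k hD hkU with ⟨d, hd, hdk⟩ | ⟨u, hu, hku⟩
      · by_cases hdS : d ∈ S
        · exact hr.not_gle (hr.lt_of_adj hdk) (hlt d hdS).1
        · exact hk.indep_left d (.inr ⟨hd, hdS⟩) k (.inl rfl) hdk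
      · exact hk.no_edge k (.inl rfl) u hu hku
    · have hkD : k ∉ D := fun hd => Set.disjoint_left.1 hk.disjoint hd (Set.mem_insert _ _)
      rcases h k hkD hU with ⟨d, hd, hdk⟩ | ⟨u, hu, hku⟩
      · exact hk.no_edge d hd k (.inl rfl) hdk
      · by_cases huS : u ∈ S
        · exact hr.not_gle (hr.lt_of_adj hku) (hlt u huS).1
        · exact hk.indep_right k (.inl rfl) u (.inr ⟨hu, huS⟩) hku

namespace TightPair

/-- The first component of a tight pair. -/
def down (x : TightPair G) : Set V := x.1.1

/-- The second component of a tight pair. -/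
def up (x : TightPair G) : Set V := x.1.2

theorem ext {x y : TightPair G} (h : x.down = y.down) (h' : x.up = y.up) : x = y :=
  Subtype.ext (Prod.ext h h')

instance [Finite V] : Finite (TightPair G) :=
  inferInstanceAs (Finite {p : Set V × Set V // IsTightPair G p.1 p.2})

variable (x : TightPair G) {a b : V}

theorem not_adj_down (ha : a ∈ x.down) (hb : b ∈ x.down) : ¬ G.Adj a b :=
  x.2.orthogonal.indep_left a ha b hb

theorem not_adj_up (ha : a ∈ x.up) (hb : b ∈ x.up) : ¬ G.Adj a b :=
  x.2.orthogonal.indep_right a ha b hb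

theorem not_adj (ha : a ∈ x.down) (hb : b ∈ x.up) : ¬ G.Adj a b :=
  x.2.orthogonal.no_edge a ha b hb

theorem notMem_up (ha : a ∈ x.down) : a ∉ x.up :=
  Set.disjoint_left.1 x.2.orthogonal.disjoint ha

theorem notMem_down (ha : a ∈ x.up) : a ∉ x.down :=
  Set.disjoint_right.1 x.2.orthogonal.disjoint ha

theorem exists_adj {r : V → ℤ} (hr : IsRank G r) (hD : a ∉ x.down) (hU : a ∉ x.up) :
    (∃ d ∈ x.down, G.Adj d a) ∨ ∃ u ∈ x.up, G.Adj a u :=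
  ((isTightPair_iff hr).1 x.2).2 a hD hU

end TightPair

/-! ### Duality by edge reversal, and flips described without an algorithm. -/

/-- The graph with all edges reversed. -/
def op (G : Digraph V) : Digraph V := ⟨fun a b => G.Adj b a⟩

@[simp] theorem op_adj {a b : V} : (op G).Adj a b ↔ G.Adj b a := Iff.rfl

@[simp] theorem gle_op {a b : V} : GLE (op G) a b ↔ GLE G b a :=
  Relation.reflTransGen_swap

theorem IsRank.op {r : V → ℤ} (hr : IsRank G r) : IsRank (op G) (fun v => -r v) :=
  ⟨fun _ _ h => hr.injective (neg_injective h), fun h => neg_lt_neg (hr.lt_of_adj h)⟩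

theorem IsReverseLinearExtension.pairwise {l : List V} (hl : IsReverseLinearExtension G l) :
    l.Pairwise fun a b => ¬ G.Adj b a := by
  have := hl.sorted
  rwa [List.pairwise_reverse] at this

theorem IsReverseLinearExtension.op {l : List V} (hl : IsReverseLinearExtension G l) :
    IsLinearExtension (op G) l :=
  ⟨List.nodup_reverse.1 hl.nodup, fun v => List.mem_reverse.1 (hl.mem v), hl.pairwise⟩

theorem IsLinearExtension.op {l : List V} (hl : IsLinearExtension G l) :
    IsReverseLinearExtension (op G) l :=
  ⟨List.nodup_reverse.2 hl.nodup, fun v => List.mem_reverse.2 (hl.mem v), by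
    rw [List.pairwise_reverse]; exact hl.sorted⟩

theorem IsOrthogonalPair.op {D U : Set V} (h : IsOrthogonalPair G D U) :
    IsOrthogonalPair (op G) U D :=
  ⟨fun a ha b hb => h.indep_right b hb a ha, fun a ha b hb => h.indep_left b hb a ha,
    h.disjoint.symm, fun d hd u hu => h.no_edge u hu d hd⟩

theorem IsTightPair.op {D U : Set V} (h : IsTightPair G D U) : IsTightPair (op G) U D :=
  ⟨h.orthogonal.op,
    fun k hk S hS hlt ho => h.tight_right k hk S hS
      (fun s hs => ⟨gle_op.1 (hlt s hs).1, (hlt s hs).2.symm⟩) ho.op,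
    fun k hk S hS hlt ho => h.tight_left k hk S hS
      (fun s hs => ⟨gle_op.1 (hlt s hs).1, (hlt s hs).2.symm⟩) ho.op⟩

/-- Tight pairs of `G` are tight pairs of the reversed graph with the components swapped. -/
def TightPair.swap : TightPair G ≃ TightPair (op G) where
  toFun x := ⟨(x.1.2, x.1.1), x.2.op⟩
  invFun x := ⟨(x.1.2, x.1.1), x.2.op⟩
  left_inv _ := rfl
  right_inv _ := rfl

/-- `y` is obtained from `x` by moving `g` from `U` to `D`, changing `D` only weakly below `g` and
`U` only weakly above `g`. -/
structure IsFlip (G : Digraph V) (g : V) (x y : TightPair G) : Prop where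
  mem_up : g ∈ x.up
  mem_down : g ∈ y.down
  down_iff : ∀ {k}, ¬ GLE G k g → (k ∈ x.down ↔ k ∈ y.down)
  up_iff : ∀ {k}, ¬ GLE G g k → (k ∈ x.up ↔ k ∈ y.up)

theorem IsFlip.swap {g : V} {x y : TightPair G} (h : IsFlip G g x y) :
    IsFlip (op G) g y.swap x.swap :=
  ⟨h.mem_down, h.mem_up, fun hk => (h.up_iff fun h' => hk (gle_op.2 h')).symm,
    fun hk => (h.down_iff fun h' => hk (gle_op.2 h')).symm⟩

/-! ### Tight pairs determined by partial data. -/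

section Uniqueness

variable [Finite V] {r : V → ℤ}

/-- By tightness, membership of `k` in `D` is decided by the in-neighbours of `k` in `D`, the
out-neighbours of `k` in `U`, and whether `k ∈ U`. Induction from high rank to low takes care of the
in-neighbours. -/
theorem down_eq_down (hr : IsRank G r) {x y : TightPair G}
    (h : ∀ k, (k ∈ x.down ↔ k ∈ y.down) ∨
      ((k ∈ x.up ↔ k ∈ y.up) ∧ ∀ u, G.Adj k u → (u ∈ x.up ↔ u ∈ y.up))) :
    x.down = y.down := by
  ext k
  induction k using (IsRank.wellFounded fun v => -r v).induction with
  | _ k ih =>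
  have ih' : ∀ d, G.Adj d k → (d ∈ x.down ↔ d ∈ y.down) := fun d hd =>
    ih d (neg_lt_neg (hr.lt_of_adj hd))
  rcases h k with hk | ⟨hk, hu⟩
  · exact hk
  constructor
  · intro hx
    by_contra hy
    rcases y.exists_adj hr hy (hk.not.1 (x.notMem_up hx)) with ⟨d, hd, hdk⟩ | ⟨u, hu', hku⟩
    · exact x.not_adj_down ((ih' d hdk).2 hd) hx hdk
    · exact x.not_adj hx ((hu u hku).2 hu') hku
  · intro hy
    by_contra hx
    rcases x.exists_adj hr hx (hk.not.2 (y.notMem_up hy)) with ⟨d, hd, hdk⟩ | ⟨u, hu', hku⟩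
    · exact y.not_adj_down ((ih' d hdk).1 hd) hy hdk
    · exact y.not_adj hy ((hu u hku).1 hu') hku

theorem eq_of_up_eq (hr : IsRank G r) {x y : TightPair G} (h : x.up = y.up) : x = y :=
  TightPair.ext (down_eq_down hr fun k => by simp [h]) h

theorem eq_of_down_eq (hr : IsRank G r) {x y : TightPair G} (h : x.down = y.down) : x = y :=
  TightPair.swap.injective (eq_of_up_eq hr.op h)

/-- The flip prescribes `D` at `g` and at all vertices not below `g`. At a vertex strictly below `g`
it prescribes `U` there and at all out-neighbours, so the second alternative of `down_eq_down`
applies. -/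
theorem IsFlip.unique (hr : IsRank G r) {g : V} {x y z : TightPair G} (hy : IsFlip G g x y)
    (hz : IsFlip G g x z) : y = z := by
  refine eq_of_down_eq hr (down_eq_down hr fun k => ?_)
  by_cases hkg : GLE G k g
  · by_cases e : k = g
    · exact .inl (iff_of_true (e ▸ hy.mem_down) (e ▸ hz.mem_down))
    · have hgk : ¬ GLE G g k := fun h => e (hr.gle_antisymm hkg h)
      refine .inr ⟨(hy.up_iff hgk).symm.trans (hz.up_iff hgk), fun u hu => ?_⟩
      have hgu : ¬ GLE G g u := fun h => hgk (h.trans (.of_adj hu))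
      exact (hy.up_iff hgu).symm.trans (hz.up_iff hgu)
  · exact .inl ((hy.down_iff hkg).symm.trans (hz.down_iff hkg))

end Uniqueness

/-! ### Greedy enlargement. -/

section Greedy

/-- Greedily enlarge `D` by the elements of the list that satisfy `P` and are not related to by
elements of the current set. -/
def greedy (A : V → V → Prop) (P : V → Prop) (l : List V) (D : Set V) : Set V :=
  l.foldl (fun D k => {x | x ∈ D ∨ (x = k ∧ P k ∧ ∀ i ∈ D, ¬ A i k)}) D

variable {A : V → V → Prop} {P : V → Prop}

theorem subset_greedy (l : List V) (D : Set V) : D ⊆ greedy A P l D := by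
  induction l generalizing D with
  | nil => exact subset_rfl
  | cons k l ih => exact Set.Subset.trans (fun x hx => .inl hx) (ih _)

theorem of_mem_greedy {l : List V} {D : Set V} {x : V} (hx : x ∈ greedy A P l D) (hD : x ∉ D) :
    x ∈ l ∧ P x := by
  induction l generalizing D with
  | nil => exact absurd hx hD
  | cons k l ih =>
    by_cases h : x = k ∧ P k ∧ ∀ i ∈ D, ¬ A i k
    · exact ⟨h.1 ▸ List.mem_cons_self, h.1 ▸ h.2.1⟩
    · obtain ⟨h1, h2⟩ := ih hx (by rintro (h' | h'); exacts [hD h', h h'])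
      exact ⟨List.mem_cons_of_mem _ h1, h2⟩

theorem mem_greedy_or {l : List V} {D : Set V} {x : V} (hx : x ∈ l) (hP : P x) :
    x ∈ greedy A P l D ∨ ∃ i ∈ greedy A P l D, A i x := by
  induction l generalizing D with
  | nil => simp at hx
  | cons k l ih =>
    rcases List.mem_cons.1 hx with rfl | hx
    · by_cases h : ∀ i ∈ D, ¬ A i x
      · exact .inl (subset_greedy l _ (.inr ⟨rfl, hP, h⟩))
      · push Not at h
        obtain ⟨i, hi, hix⟩ := h
        exact .inr ⟨i, subset_greedy l _ (.inl hi), hix⟩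
    · exact ih hx

theorem not_rel_of_mem_greedy (hA : ∀ a, ¬ A a a) {l : List V}
    (hl : l.Pairwise fun a b => ¬ A b a) {D : Set V} {x : V} (hx : x ∈ greedy A P l D)
    (hD : x ∉ D) : ∀ i ∈ greedy A P l D, ¬ A i x := by
  induction l generalizing D with
  | nil => exact absurd hx hD
  | cons k l ih =>
    rw [List.pairwise_cons] at hl
    by_cases h : x = k ∧ P k ∧ ∀ i ∈ D, ¬ A i k
    · obtain ⟨rfl, h1, h2⟩ := h
      intro i hi
      by_cases h' : i ∈ {y | y ∈ D ∨ (y = x ∧ P x ∧ ∀ i ∈ D, ¬ A i x)}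
      · rcases h' with h' | h'
        · exact h2 i h'
        · exact h'.1 ▸ hA _
      · exact hl.1 i (of_mem_greedy (P := P) (show i ∈ greedy A P l _ from hi) h').1
    · exact ih hl.2 hx (by rintro (h' | h'); exacts [hD h', h h'])

theorem greedyDown_eq (g : V) (l : List V) (U D : Set V) :
    greedyDown G g l U D =
      greedy G.Adj (fun k => ¬ GLE G g k ∧ k ∉ U ∧ ∀ i ∈ U, ¬ G.Adj k i) l D := by
  simp only [greedyDown, greedy, and_assoc]

theorem greedyUp_eq (g : V) (l : List V) (U D : Set V) :
    greedyUp G g l D U =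
      greedy (op G).Adj (fun k => ¬ GLE G k g ∧ k ∉ D ∧ ∀ i ∈ D, ¬ G.Adj i k) l U := by
  simp only [greedyUp, greedy, and_assoc, op_adj]

end Greedy

/-! ### The greedy algorithm computes the flip. -/

section Flip

variable {r : V → ℤ} {l l' : List V}

theorem flip_spec (hr : IsRank G r) (hl : IsLinearExtension G l)
    (hl' : IsReverseLinearExtension G l') (x : TightPair G) {g : V} (hg : g ∈ x.up) :
    ∃ y : TightPair G, flip G l l' g x.1 = y.1 ∧ IsFlip G g x y := by
  have hirr : ∀ a, ¬ G.Adj a a := fun a => hr.not_adj le_rfl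
  have hgd : g ∉ x.down := x.notMem_down hg
  set U₀ := keepUp G g x.1.1 x.1.2 with hU₀
  set D₀ := keepDown G g x.1.1 x.1.2 with hD₀
  have mU₀ : ∀ {k}, k ∈ U₀ ↔ k ∈ x.up ∧ ¬ GLE G g k := fun {k} =>
    ⟨fun h => h.resolve_right fun h' => hgd h'.2, fun h => .inl h⟩
  have mD₀ : ∀ {k}, k ∈ D₀ ↔ k ∈ x.down ∧ ¬ GLE G k g ∨ k = g := fun {k} =>
    ⟨fun h => h.imp_right And.left, fun h => h.imp_right fun h' => ⟨h', hg⟩⟩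
  set D' := greedyDown G g l' U₀ D₀ with hD'
  set U' := greedyUp G g l D' U₀ with hU'
  have hflip : flip G l l' g x.1 = (D', U') := if_pos (Or.inr hg)
  have hDsub : D₀ ⊆ D' := by rw [hD', greedyDown_eq]; exact subset_greedy _ _
  have hDmem : ∀ {k}, k ∈ D' → k ∉ D₀ → ¬ GLE G g k ∧ k ∉ U₀ ∧ ∀ i ∈ U₀, ¬ G.Adj k i := by
    intro k hk hk'
    rw [hD', greedyDown_eq] at hk
    exact (of_mem_greedy hk hk').2
  have hDcov : ∀ {k}, ¬ GLE G g k → k ∉ U₀ → (∀ i ∈ U₀, ¬ G.Adj k i) → k ∉ D' →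
      ∃ i ∈ D', G.Adj i k := by
    intro k h1 h2 h3 h4
    rw [hD', greedyDown_eq] at h4 ⊢
    exact (mem_greedy_or (List.mem_reverse.1 (hl'.mem k)) ⟨h1, h2, h3⟩).resolve_left h4
  have hDind : ∀ {k}, k ∈ D' → k ∉ D₀ → ∀ i ∈ D', ¬ G.Adj i k := by
    intro k hk hk'
    rw [hD', greedyDown_eq] at hk ⊢
    exact not_rel_of_mem_greedy hirr hl'.pairwise hk hk'
  have hUsub : U₀ ⊆ U' := by rw [hU', greedyUp_eq]; exact subset_greedy _ _
  have hUmem : ∀ {k}, k ∈ U' → k ∉ U₀ → ¬ GLE G k g ∧ k ∉ D' ∧ ∀ i ∈ D', ¬ G.Adj i k := by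
    intro k hk hk'
    rw [hU', greedyUp_eq] at hk
    exact (of_mem_greedy hk hk').2
  have hUcov : ∀ {k}, ¬ GLE G k g → k ∉ D' → (∀ i ∈ D', ¬ G.Adj i k) → k ∉ U' →
      ∃ i ∈ U', G.Adj k i := by
    intro k h1 h2 h3 h4
    rw [hU', greedyUp_eq] at h4 ⊢
    exact (mem_greedy_or (hl.mem k) ⟨h1, h2, h3⟩).resolve_left h4
  have hUind : ∀ {k}, k ∈ U' → k ∉ U₀ → ∀ i ∈ U', ¬ G.Adj k i := by
    intro k hk hk'
    rw [hU', greedyUp_eq] at hk ⊢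
    exact not_rel_of_mem_greedy (A := (op G).Adj) hirr hl.sorted hk hk'
  have hgD' : g ∈ D' := hDsub (mD₀.2 (.inr rfl))
  -- Otherwise tightness of `x` gives an edge to `k` from `x.down` or from `k` to `x.up`. Its other
  -- end is again not below `g`, respectively not above `g`, hence was kept and blocks `k`.
  have hDlt : ∀ {k}, k ∈ D' → k ∉ D₀ → GLE G k g := by
    intro k hk hk'
    by_contra hkg
    obtain ⟨h1, h2, h3⟩ := hDmem hk hk'
    have hkd : k ∉ x.down := fun h => hk' (mD₀.2 (.inl ⟨h, hkg⟩))
    have hku : k ∉ x.up := fun h => h2 (mU₀.2 ⟨h, h1⟩)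
    rcases x.exists_adj hr hkd hku with ⟨d, hd, hdk⟩ | ⟨u, hu, hku⟩
    · exact hDind hk hk' d (hDsub (mD₀.2 (.inl ⟨hd, fun h => hkg ((GLE.of_adj hdk).trans h)⟩))) hdk
    · exact h3 u (mU₀.2 ⟨hu, fun h => h1 (h.trans (.of_adj hku))⟩) hku
  -- A vertex not above `g` was already a candidate in the pass for `D'`, so it lies in `D'` or has
  -- an edge from `D'` or to `U₀`.
  have hUgt : ∀ {k}, k ∈ U' → k ∉ U₀ → GLE G g k := by
    intro k hk hk'
    by_contra hgk
    obtain ⟨-, h2, h3⟩ := hUmem hk hk'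
    obtain ⟨i, hi, hik⟩ := hDcov hgk hk' (fun i hi => hUind hk hk' i (hUsub hi)) h2
    exact h3 i hi hik
  have hDU₀ : ∀ {d u}, d ∈ D' → u ∈ U₀ → d ≠ u ∧ ¬ G.Adj d u := by
    intro d u hd hu
    by_cases hd' : d ∈ D₀
    · rcases mD₀.1 hd' with ⟨h, -⟩ | rfl
      · exact ⟨fun e => x.notMem_up h (e ▸ (mU₀.1 hu).1), x.not_adj h (mU₀.1 hu).1⟩
      · exact ⟨fun e => (mU₀.1 hu).2 (e ▸ .refl), x.not_adj_up hg (mU₀.1 hu).1⟩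
    · obtain ⟨-, h2, h3⟩ := hDmem hd hd'
      exact ⟨fun e => h2 (e ▸ hu), h3 u hu⟩
  have hDU : ∀ {d u}, d ∈ D' → u ∈ U' → d ≠ u ∧ ¬ G.Adj d u := by
    intro d u hd hu
    by_cases hu' : u ∈ U₀
    · exact hDU₀ hd hu'
    · obtain ⟨-, h2, h3⟩ := hUmem hu hu'
      exact ⟨fun e => h2 (e ▸ hd), h3 d hd⟩
  have htight : IsTightPair G D' U' := by
    refine (isTightPair_iff hr).2 ⟨⟨?_, ?_, ?_, fun d hd u hu => (hDU hd hu).2⟩, ?_⟩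
    · intro a ha b hb hab
      by_cases hb' : b ∈ D₀
      · by_cases ha' : a ∈ D₀
        · rcases mD₀.1 ha' with ⟨ha1, ha2⟩ | rfl <;> rcases mD₀.1 hb' with ⟨hb1, hb2⟩ | rfl
          · exact x.not_adj_down ha1 hb1 hab
          · exact x.not_adj ha1 hg hab
          · exact hb2 (.of_adj hab)
          · exact hirr _ hab
        · have hag := hDlt ha ha'
          rcases mD₀.1 hb' with ⟨-, hb2⟩ | rfl
          · exact hb2 ((GLE.of_adj hab).trans hag)
          · exact (hDmem ha ha').1 (.of_adj hab)
      · exact hDind hb hb' a ha hab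
    · intro a ha b hb hab
      by_cases ha' : a ∈ U₀
      · by_cases hb' : b ∈ U₀
        · exact x.not_adj_up (mU₀.1 ha').1 (mU₀.1 hb').1 hab
        · exact (mU₀.1 ha').2 ((hUgt hb hb').trans (.of_adj hab))
      · exact hUind ha ha' b hb hab
    · exact Set.disjoint_left.2 fun a ha ha' => (hDU ha ha').1 rfl
    · intro k hkD hkU
      by_contra! hk
      by_cases hgk : GLE G g k
      · have hkg : ¬ GLE G k g := fun h => hkD (hr.gle_antisymm hgk h ▸ hgD')
        obtain ⟨u, hu, hku⟩ := hUcov hkg hkD hk.1 hkU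
        exact hk.2 u hu hku
      · obtain ⟨d, hd, hdk⟩ := hDcov hgk (fun h => hkU (hUsub h))
          (fun i hi => hk.2 i (hUsub hi)) hkD
        exact hk.1 d hd hdk
  refine ⟨⟨(D', U'), htight⟩, hflip, hg, hgD', fun {k} hk => ?_, fun {k} hk => ?_⟩
  · refine ⟨fun h => hDsub (mD₀.2 (.inl ⟨h, hk⟩)), fun h => ?_⟩
    by_cases h' : k ∈ D₀
    · exact ((mD₀.1 h').resolve_right fun e => hk (e ▸ .refl)).1
    · exact absurd (hDlt h h') hk
  · refine ⟨fun h => hUsub (mU₀.2 ⟨h, hk⟩), fun h => ?_⟩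
    by_cases h' : k ∈ U₀
    · exact (mU₀.1 h').1
    · exact absurd (hUgt h h') hk

theorem exists_isFlip_up (hr : IsRank G r) (hl : IsLinearExtension G l)
    (hl' : IsReverseLinearExtension G l') (x : TightPair G) {g : V} (hg : g ∈ x.up) :
    ∃ y, IsFlip G g x y :=
  (flip_spec hr hl hl' x hg).imp fun _ h => h.2

theorem exists_isFlip_down (hr : IsRank G r) (hl : IsLinearExtension G l)
    (hl' : IsReverseLinearExtension G l') (x : TightPair G) {g : V} (hg : g ∈ x.down) :
    ∃ y, IsFlip G g y x := by
  obtain ⟨y, hy⟩ := exists_isFlip_up hr.op hl'.op hl.op x.swap (g := g) hg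
  exact ⟨TightPair.swap (G := op G) y, hy.swap⟩

theorem upFlip_iff [Finite V] (hr : IsRank G r) (hl : IsLinearExtension G l)
    (hl' : IsReverseLinearExtension G l') {x y : TightPair G} :
    UpFlip G l l' x y ↔ ∃ g, IsFlip G g x y := by
  constructor
  · rintro ⟨g, hg, h⟩
    obtain ⟨z, hz, hxz⟩ := flip_spec hr hl hl' x hg
    exact ⟨g, (Subtype.ext (h.symm.trans hz) : y = z) ▸ hxz⟩
  · rintro ⟨g, hg⟩
    obtain ⟨z, hz, hxz⟩ := flip_spec hr hl hl' x hg.mem_up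
    exact ⟨g, hg.mem_up, hg.unique hr hxz ▸ hz⟩

/-- The order on tight pairs generated by flips. -/
def FlipLE (G : Digraph V) : TightPair G → TightPair G → Prop :=
  Relation.ReflTransGen fun x y => ∃ g, IsFlip G g x y

theorem indepLE_eq_flipLE [Finite V] (hr : IsRank G r) (hl : IsLinearExtension G l)
    (hl' : IsReverseLinearExtension G l') : IndepLE G l l' = FlipLE G := by
  have : UpFlip G l l' = fun x y => ∃ g, IsFlip G g x y := by
    funext x y
    exact propext (upFlip_iff hr hl hl')
  rw [IndepLE, FlipLE, this]

end Flip

/-! ### The partial order generated by flips and its covers. -/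

variable {r : V → ℤ} {l l' : List V}

theorem IsFlip.flipLE {g : V} {x y : TightPair G} (h : IsFlip G g x y) : FlipLE G x y :=
  Relation.ReflTransGen.single ⟨g, h⟩

theorem FlipLE.trans {x y z : TightPair G} (h : FlipLE G x y) (h' : FlipLE G y z) :
    FlipLE G x z :=
  Relation.ReflTransGen.trans h h'

theorem FlipLE.swap {x y : TightPair G} (h : FlipLE G x y) : FlipLE (op G) y.swap x.swap := by
  induction h with
  | refl => exact .refl
  | tail _ h ih => exact FlipLE.trans (h.choose_spec.swap.flipLE) ih

/-- Along a nonempty sequence of flips, `D` increases lexicographically, and the first difference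
is not ranked below any of the flips. -/
theorem IsFlip.exists_lex (hr : IsRank G r) {h : V} {w x x₁ y : TightPair G} (hw : FlipLE G w x)
    (hx : IsFlip G h x x₁) (hy : FlipLE G x₁ y) : ∃ c, r h ≤ r c ∧ c ∉ w.down ∧ c ∈ y.down ∧
      ∀ k, r c < r k → (k ∈ w.down ↔ k ∈ y.down) := by
  induction hw using Relation.ReflTransGen.head_induction_on with
  | refl =>
    induction hy with
    | refl =>
      exact ⟨h, le_rfl, x.notMem_down hx.mem_up, hx.mem_down,
        fun k hk => hx.down_iff (hr.not_gle hk)⟩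
    | @tail y z _ hyz ih =>
      obtain ⟨c, h1, h2, h3, h4⟩ := ih
      obtain ⟨d, hd⟩ := hyz
      have hdy := y.notMem_down hd.mem_up
      -- The higher of the old difference `c` and the new flip `d` is the new first difference; they
      -- cannot coincide, since `c` lies in `y.down` and `d` in `y.up`.
      rcases lt_trichotomy (r c) (r d) with hlt | heq | hlt
      · exact ⟨d, h1.trans hlt.le, (h4 d hlt).not.2 hdy, hd.mem_down,
          fun k hk => (h4 k (hlt.trans hk)).trans (hd.down_iff (hr.not_gle hk))⟩
      · exact absurd (hr.injective heq ▸ h3) hdy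
      · exact ⟨c, h1, h2, (hd.down_iff (hr.not_gle hlt)).1 h3,
          fun k hk => (h4 k hk).trans (hd.down_iff (hr.not_gle (hlt.trans hk)))⟩
  | @head v w hvw _ ih =>
    obtain ⟨c, h1, h2, h3, h4⟩ := ih
    obtain ⟨d, hd⟩ := hvw
    have hdv := v.notMem_down hd.mem_up
    rcases lt_trichotomy (r c) (r d) with hlt | heq | hlt
    · exact ⟨d, h1.trans hlt.le, hdv, (h4 d hlt).1 hd.mem_down,
        fun k hk => (hd.down_iff (hr.not_gle hk)).trans (h4 k (hlt.trans hk))⟩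
    · exact absurd hd.mem_down (hr.injective heq ▸ h2)
    · exact ⟨c, h1, (hd.down_iff (hr.not_gle hlt)).not.2 h2, h3,
        fun k hk => (hd.down_iff (hr.not_gle (hlt.trans hk))).trans (h4 k hk)⟩

theorem IsFlip.not_flipLE (hr : IsRank G r) {g : V} {x y : TightPair G} (h : IsFlip G g x y) :
    ¬ FlipLE G y x := fun h' =>
  let ⟨_, _, h1, h2, _⟩ := h.exists_lex hr .refl h'
  h1 h2

theorem FlipLE.eq_or_exists {x y : TightPair G} (h : FlipLE G x y) :
    x = y ∨ ∃ g z, IsFlip G g x z ∧ FlipLE G z y := by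
  rcases Relation.ReflTransGen.cases_head h with h | ⟨z, ⟨g, hg⟩, hz⟩
  · exact .inl h
  · exact .inr ⟨g, z, hg, hz⟩

theorem FlipLE.antisymm (hr : IsRank G r) {x y : TightPair G} (h : FlipLE G x y)
    (h' : FlipLE G y x) : x = y := by
  rcases h.eq_or_exists with h | ⟨g, z, hg, hz⟩
  · exact h
  · exact absurd (hz.trans h') (hg.not_flipLE hr)

theorem flip_wellFounded [Finite V] (hr : IsRank G r) :
    WellFounded fun x y : TightPair G => FlipLE G x y ∧ x ≠ y :=
  haveI : IsTrans (TightPair G) fun x y => FlipLE G x y ∧ x ≠ y :=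
    ⟨fun _ _ _ h h' => ⟨h.1.trans h'.1, fun e => h.2 (h.1.antisymm hr (e ▸ h'.1))⟩⟩
  haveI : Std.Irrefl fun x y : TightPair G => FlipLE G x y ∧ x ≠ y := ⟨fun _ h => h.2 rfl⟩
  Finite.wellFounded_of_trans_of_irrefl _

theorem flip_wellFounded_swap [Finite V] (hr : IsRank G r) :
    WellFounded fun x y : TightPair G => FlipLE G y x ∧ y ≠ x :=
  haveI : IsTrans (TightPair G) fun x y => FlipLE G y x ∧ y ≠ x :=
    ⟨fun _ _ _ h h' => ⟨h'.1.trans h.1, fun e => h'.2 (h'.1.antisymm hr (e ▸ h.1))⟩⟩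
  haveI : Std.Irrefl fun x y : TightPair G => FlipLE G y x ∧ y ≠ x := ⟨fun _ h => h.2 rfl⟩
  Finite.wellFounded_of_trans_of_irrefl _

theorem IsFlip.flipLE_and_ne (hr : IsRank G r) {g : V} {x y : TightPair G} (h : IsFlip G g x y) :
    FlipLE G x y ∧ x ≠ y :=
  ⟨h.flipLE, fun e => h.not_flipLE hr (e ▸ .refl)⟩

/-- A flip is a covering relation. -/
theorem IsFlip.eq_or_eq [Finite V] (hr : IsRank G r) {g : V} {x y z : TightPair G}
    (h : IsFlip G g x y) (hxz : FlipLE G x z) (hzy : FlipLE G z y) : z = x ∨ z = y := by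
  rcases hxz.eq_or_exists with e | ⟨c, x₁, hc, hx₁⟩
  · exact .inl e.symm
  -- The first difference between `x.down` and `y.down` ranks at least as high as `c`, and lies
  -- below `g` because `y` is the flip of `x` at `g`. The dual argument for `U` gives `r g ≤ r c`.
  have hcg : r c ≤ r g := by
    obtain ⟨d, h1, h2, h3, -⟩ := hc.exists_lex hr .refl (hx₁.trans hzy)
    exact h1.trans (hr.le_of_gle (not_not.1 fun hdg => h2 ((h.down_iff hdg).2 h3)))
  have hgc : r g ≤ r c := by
    obtain ⟨d, h1, h2, h3, -⟩ := hc.swap.exists_lex hr.op (hx₁.trans hzy).swap .refl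
    exact (hr.le_of_gle (not_not.1 fun hgd => h2 ((h.up_iff hgd).1 h3))).trans (neg_le_neg_iff.1 h1)
  have e := hr.injective (le_antisymm hcg hgc)
  subst e
  exact .inr (hzy.antisymm hr (hc.unique hr h ▸ hx₁))

/-! ### Tight pairs with a singleton component. -/

/-- The vertices outside `B` without an edge to `B`. -/
def perpL (G : Digraph V) (B : Set V) : Set V := {v | v ∉ B ∧ ∀ b ∈ B, ¬ G.Adj v b}

/-- The vertices outside `A` without an edge from `A`. -/
def perpR (G : Digraph V) (A : Set V) : Set V := {v | v ∉ A ∧ ∀ a ∈ A, ¬ G.Adj a v}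

/-- Below any tight pair `x` there is a tight pair with `D = {a}`, for each `a` outside `U` that has
no edge to `U`. -/
theorem exists_down_eq_singleton [Finite V] (hr : IsRank G r) (hl : IsLinearExtension G l)
    (hl' : IsReverseLinearExtension G l') {a : V} (x : TightPair G) (hx : a ∈ perpL G x.up) :
    ∃ j : TightPair G, j.down = {a} ∧ FlipLE G j x := by
  induction x using (flip_wellFounded hr).induction with
  | _ x ih =>
  -- Flipping down at `d` changes `U` only at vertices above `d`, hence neither at `a` nor at its
  -- out-neighbours.
  by_cases h : ∃ d ∈ x.down, r a < r d
  · obtain ⟨d, hd, had⟩ := h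
    obtain ⟨y, hy⟩ := exists_isFlip_down hr hl hl' x hd
    obtain ⟨j, hj, hjy⟩ := ih y (hy.flipLE_and_ne hr)
      ⟨(hy.up_iff (hr.not_gle had)).not.2 hx.1, fun u hu hau => hx.2 u
        ((hy.up_iff (hr.not_gle ((hr.lt_of_adj hau).trans had))).1 hu) hau⟩
    exact ⟨j, hj, hjy.trans hy.flipLE⟩
  push Not at h
  have hax : a ∈ x.down := by
    by_contra hax
    rcases x.exists_adj hr hax hx.1 with ⟨d, hd, hda⟩ | ⟨u, hu, hau⟩
    · exact hr.not_adj (h d hd) hda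
    · exact hx.2 u hu hau
  by_cases h' : ∃ d ∈ x.down, d ≠ a
  · obtain ⟨d, hd, hda⟩ := h'
    have hlt : r d < r a := (h d hd).lt_of_ne (hr.injective.ne hda)
    obtain ⟨y, hy⟩ := exists_isFlip_down hr hl hl' x hd
    have hay : a ∈ y.down := (hy.down_iff (hr.not_gle hlt)).2 hax
    obtain ⟨j, hj, hjy⟩ := ih y (hy.flipLE_and_ne hr)
      ⟨y.notMem_up hay, fun u hu => y.not_adj hay hu⟩
    exact ⟨j, hj, hjy.trans hy.flipLE⟩
  · push Not at h'
    exact ⟨x, Set.eq_singleton_iff_unique_mem.2 ⟨hax, h'⟩, .refl⟩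

theorem exists_up_eq_singleton [Finite V] (hr : IsRank G r) (hl : IsLinearExtension G l)
    (hl' : IsReverseLinearExtension G l') {b : V} (x : TightPair G) (hx : b ∈ perpR G x.down) :
    ∃ m : TightPair G, m.up = {b} ∧ FlipLE G x m := by
  obtain ⟨j, hj, h⟩ := exists_down_eq_singleton hr.op hl'.op hl.op x.swap hx
  exact ⟨TightPair.swap (G := op G) j, hj, h.swap⟩

/-- If no vertex of rank at most `n` is in `U`, the same holds for all larger tight pairs. -/
theorem FlipLE.notMem_up (hr : IsRank G r) {n : ℤ} {x y : TightPair G} (h : FlipLE G x y)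
    (hx : ∀ c, r c ≤ n → c ∉ x.up) : ∀ c, r c ≤ n → c ∉ y.up := by
  induction h with
  | refl => exact hx
  | @tail y z _ hyz ih =>
    obtain ⟨g, hg⟩ := hyz
    have hng : n < r g := not_le.1 fun h => ih g h hg.mem_up
    exact fun c hc => (hg.up_iff (hr.not_gle (hc.trans_lt hng))).not.1 (ih c hc)

/-- Every set of vertices contains an independent subset that absorbs it. -/
theorem exists_kernel (hr : IsRank G r) (hl : IsLinearExtension G l) (Y : Set V) :
    ∃ U ⊆ Y, IsIndependent G U ∧ ∀ k ∈ Y, k ∉ U → ∃ u ∈ U, G.Adj k u := by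
  have hirr : ∀ a, ¬ G.Adj a a := fun a => hr.not_adj le_rfl
  refine ⟨greedy (op G).Adj (· ∈ Y) l ∅, fun k hk => (of_mem_greedy hk (Set.notMem_empty k)).2,
    fun a ha b hb => ?_, fun k hk hkU => (mem_greedy_or (hl.mem k) hk).resolve_left hkU⟩
  exact not_rel_of_mem_greedy (A := (op G).Adj) hirr hl.sorted ha (Set.notMem_empty a) b hb

theorem exists_down_singleton (hr : IsRank G r) (hl : IsLinearExtension G l) (a : V) :
    ∃ j : TightPair G, j.down = {a} := by
  obtain ⟨U, hU, hi, hc⟩ := exists_kernel hr hl (perpR G {a})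
  refine ⟨⟨({a}, U), (isTightPair_iff hr).2 ⟨⟨?_, hi, ?_, ?_⟩, ?_⟩⟩, rfl⟩
  · rintro _ rfl _ rfl
    exact hr.not_adj le_rfl
  · exact Set.disjoint_singleton_left.2 fun h => (hU h).1 rfl
  · exact fun d hd u hu => (hU hu).2 d hd
  · intro k hk hkU
    by_contra! h
    obtain ⟨u, hu, hku⟩ := hc k ⟨hk, h.1⟩ hkU
    exact h.2 u hu hku

theorem exists_up_singleton (hr : IsRank G r) (hl' : IsReverseLinearExtension G l') (b : V) :
    ∃ m : TightPair G, m.up = {b} :=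
  let ⟨m, hm⟩ := exists_down_singleton hr.op hl'.op b
  ⟨TightPair.swap (G := op G) m, hm⟩

/-! ### A lattice admits no five-set partition. -/

section Lattice

variable [Finite V] [Lattice (TightPair G)]

/-- The claim is strengthened from `j` to every `y` with `a ∈ y.down`, by induction upwards on `y`.
If `y.up` contains some `c` ranked below `b`, the flip of `y` at `c` covers `y` and equals `y ⊔ i`
with `i.down = {c}`, by the induction hypothesis for `c`. Since `i ≤ m`, the flip is below `m`
whenever `y` is. If there is no such `c`, then `y.up` has no vertex of rank at most `r b`, which
persists upwards and excludes `b ∈ m.up`. -/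
theorem not_flipLE_of_lattice (hr : IsRank G r) (hl : IsLinearExtension G l)
    (hl' : IsReverseLinearExtension G l') (hle : ∀ x y : TightPair G, x ≤ y ↔ FlipLE G x y)
    {a b : V} (hab : a = b ∨ G.Adj a b) {j m : TightPair G} (hj : j.down = {a})
    (hm : m.up = {b}) : ¬ FlipLE G j m := by
  induction b using (IsRank.wellFounded r).induction generalizing a j m with
  | _ b ih =>
  have hba : r b ≤ r a := hab.elim (fun e => e ▸ le_rfl) fun h => (hr.lt_of_adj h).le
  suffices H : ∀ y : TightPair G, a ∈ y.down → ¬ FlipLE G y m from H j (hj ▸ rfl)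
  intro y
  induction y using (flip_wellFounded_swap hr).induction with
  | _ y ih' =>
  intro hay hym
  by_cases hc : ∃ c ∈ y.up, r c < r b
  · obtain ⟨c, hcy, hcb⟩ := hc
    obtain ⟨z, hz⟩ := exists_isFlip_up hr hl hl' y hcy
    have haz : a ∈ z.down := (hz.down_iff (hr.not_gle (hcb.trans_le hba))).1 hay
    refine ih' z (hz.flipLE_and_ne hr) haz ?_
    obtain ⟨i, hi, hiz⟩ := exists_down_eq_singleton hr hl hl' (a := c) z
      ⟨z.notMem_up hz.mem_down, fun u hu => z.not_adj hz.mem_down hu⟩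
    obtain ⟨n, hn, hyn⟩ := exists_up_eq_singleton hr hl hl' (b := c) y
      ⟨y.notMem_down hcy, fun u hu => y.not_adj hu hcy⟩
    have him : FlipLE G i m := by
      obtain ⟨i', hi', him⟩ := exists_down_eq_singleton hr hl hl' (a := c) m
        (by
          rw [hm]
          refine ⟨fun e => hcb.ne (congrArg r e), ?_⟩
          rintro b rfl
          exact hr.not_adj hcb.le)
      exact eq_of_down_eq hr (hi.trans hi'.symm) ▸ him
    rcases hz.eq_or_eq hr (z := y ⊔ i) ((hle _ _).1 le_sup_left)
      ((hle _ _).1 (sup_le ((hle _ _).2 hz.flipLE) ((hle _ _).2 hiz))) with e | e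
    · have hiy : FlipLE G i y := (hle _ _).1 (sup_eq_left.1 e)
      exact absurd (hiy.trans hyn) (ih c hcb (.inl rfl) hi hn)
    · exact e ▸ (hle _ _).1 (sup_le ((hle _ _).2 hym) ((hle _ _).2 him))
  · push Not at hc
    refine hym.notMem_up hr (n := r b) (fun c hcb hcy => ?_) b le_rfl (hm ▸ rfl)
    have : c = b := hr.injective (le_antisymm hcb (hc c hcy))
    subst this
    rcases hab with rfl | hab
    · exact y.notMem_up hay hcy
    · exact y.not_adj hay hcy hab

theorem not_isFiveSetPartition_of_lattice (hr : IsRank G r) (hl : IsLinearExtension G l)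
    (hl' : IsReverseLinearExtension G l') (hle : ∀ x y : TightPair G, x ≤ y ↔ FlipLE G x y)
    {X₁ X₂ X₃ X₄ Z : Set V} : ¬ IsFiveSetPartition G X₁ X₂ X₃ X₄ Z := by
  intro h
  have hirr : ∀ a, ¬ G.Adj a a := fun a => hr.not_adj le_rfl
  choose j hj using exists_down_singleton hr hl
  choose m hm using exists_up_singleton hr hl'
  have hjm : ∀ {a b}, j a ≤ m b ↔ a ≠ b ∧ ¬ G.Adj a b := by
    intro a b
    constructor
    · intro hle'
      by_contra hab
      exact not_flipLE_of_lattice hr hl hl' hle (by tauto) (hj a) (hm b) ((hle _ _).1 hle')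
    · rintro ⟨h1, h2⟩
      obtain ⟨i, hi, him⟩ := exists_down_eq_singleton hr hl hl' (a := a) (m b)
        (by rw [hm]; exact ⟨h1, by rintro b rfl; exact h2⟩)
      exact (hle _ _).2 (eq_of_down_eq hr (hi.trans (hj a).symm) ▸ him)
  obtain ⟨hd12, hd13, hd14, hd1Z, hd23, hd24, hd2Z, hd34, hd3Z, hd4Z⟩ :
      Disjoint X₁ X₂ ∧ Disjoint X₁ X₃ ∧ Disjoint X₁ X₄ ∧ Disjoint X₁ Z ∧ Disjoint X₂ X₃ ∧
      Disjoint X₂ X₄ ∧ Disjoint X₂ Z ∧ Disjoint X₃ X₄ ∧ Disjoint X₃ Z ∧ Disjoint X₄ Z := by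
    have := h.disjoint
    simp only [List.pairwise_cons, List.mem_cons, List.not_mem_nil, or_false, forall_eq_or_imp,
      forall_eq] at this
    tauto
  have hfin : ∀ X : Set V, X.Nonempty → ∃ s, IsLUB (j '' X) s := by
    intro X hX
    have hne : (X.toFinite.toFinset).Nonempty := by simpa using hX
    refine ⟨X.toFinite.toFinset.sup' hne j, ?_⟩
    constructor
    · rintro _ ⟨a, ha, rfl⟩
      exact Finset.le_sup' j (by simpa using ha)
    · intro t ht
      exact Finset.sup'_le _ _ fun a ha => ht ⟨a, by simpa using ha, rfl⟩
  obtain ⟨x, hx⟩ := hfin X₄ h.nonempty₄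
  obtain ⟨y, hy⟩ := hfin (X₄ ∪ X₃) (h.nonempty₄.inl)
  have hxy : x ≤ y := hx.2 fun _ ⟨a, ha, e⟩ => hy.1 ⟨a, .inl ha, e⟩
  have hy1 : ∀ b ∈ X₁, y ≤ m b := by
    intro b hb
    refine hy.2 ?_
    rintro _ ⟨a, ha | ha, rfl⟩ <;> refine hjm.2 ⟨?_, ?_⟩
    · exact fun e => Set.disjoint_left.1 hd14 hb (e ▸ ha)
    · exact h.no_edge₄₁ a ha b hb
    · exact fun e => Set.disjoint_left.1 hd13 hb (e ▸ ha)
    · exact h.no_edge₃₁ a ha b hb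
  have hne : x ≠ y := by
    rintro rfl
    obtain ⟨b, hb⟩ := h.nonempty₂
    obtain ⟨a, ha, hab⟩ := (h.edges₂ b hb).2
    have hxb : x ≤ m b := by
      refine hx.2 ?_
      rintro _ ⟨c, hc, rfl⟩
      exact hjm.2 ⟨fun e => Set.disjoint_left.1 hd24 hb (e ▸ hc), h.no_edge₄₂ c hc b hb⟩
    exact (hjm.1 ((hy.1 ⟨a, .inr ha, rfl⟩).trans hxb)).2 hab
  -- The first flip from `x` towards `y` satisfies `x ≤ m g` and `j g ≤ z ≤ y`. These give the
  -- constraints on `g` relative to `X₄` and `X₁`.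
  obtain ⟨g, z, hg, hz⟩ := ((hle _ _).1 hxy).eq_or_exists.resolve_left hne
  have hg4 : ∀ a ∈ X₄, a ≠ g ∧ ¬ G.Adj a g := by
    intro a ha
    obtain ⟨n, hn, hxn⟩ := exists_up_eq_singleton hr hl hl' (b := g) x
      ⟨x.notMem_down hg.mem_up, fun u hu => x.not_adj hu hg.mem_up⟩
    have e : n = m g := eq_of_up_eq hr (hn.trans (hm g).symm)
    exact hjm.1 ((hx.1 ⟨a, ha, rfl⟩).trans (e ▸ (hle _ _).2 hxn))
  have hg1 : ∀ b ∈ X₁, g ≠ b ∧ ¬ G.Adj g b := by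
    intro b hb
    obtain ⟨n, hn, hnz⟩ := exists_down_eq_singleton hr hl hl' (a := g) z
      ⟨z.notMem_up hg.mem_down, fun u hu => z.not_adj hg.mem_down hu⟩
    have e : n = j g := eq_of_down_eq hr (hn.trans (hj g).symm)
    exact hjm.1 (((hle _ _).2 (e ▸ hnz.trans hz)).trans (hy1 b hb))
  have hcov : g ∈ X₁ ∪ X₂ ∪ X₃ ∪ X₄ ∪ Z := h.cover ▸ Set.mem_univ g
  rcases hcov with (((hg' | hg') | hg') | hg') | hg'
  · exact (hg1 g hg').1 rfl
  · obtain ⟨b, hb, hgb⟩ := (h.edges₂ g hg').1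
    exact (hg1 b hb).2 hgb
  · obtain ⟨a, ha, hag⟩ := (h.edges₃ g hg').1
    exact (hg4 a ha).2 hag
  · exact (hg4 g hg').1 rfl
  · obtain ⟨a, ha, hag⟩ := (h.edgesZ g hg').1
    exact (hg4 a ha).2 hag

end Lattice

/-! ### Maximal orthogonal pairs and overlapping inclusions. -/

theorem subset_perpL_iff {A B : Set V} : A ⊆ perpL G B ↔ B ⊆ perpR G A :=
  ⟨fun h b hb => ⟨fun hA => (h hA).1 hb, fun _ ha => (h ha).2 b hb⟩,
    fun h a ha => ⟨fun hB => (h hB).1 ha, fun _ hb => (h hb).2 a ha⟩⟩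

theorem perpR_anti {A B : Set V} (h : A ⊆ B) : perpR G B ⊆ perpR G A :=
  fun _ hk => ⟨fun h' => hk.1 (h h'), fun a ha => hk.2 a (h ha)⟩

theorem perpL_anti {A B : Set V} (h : A ⊆ B) : perpL G B ⊆ perpL G A :=
  fun _ hk => ⟨fun h' => hk.1 (h h'), fun a ha => hk.2 a (h ha)⟩

/-- Pairs of sets, each of which consists of all vertices orthogonal to the other set. These are the
maximal pairs of disjoint sets without an edge from the first to the second. -/
structure IsMaximalPair (G : Digraph V) (X Y : Set V) : Prop where
  right_eq : Y = perpR G X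
  left_eq : X = perpL G Y

theorem isMaximalPair_closure (A : Set V) :
    IsMaximalPair G (perpL G (perpR G A)) (perpR G A) :=
  ⟨(subset_perpL_iff.1 subset_rfl).antisymm (perpR_anti (subset_perpL_iff.2 subset_rfl)), rfl⟩

theorem isMaximalPair_closure' (B : Set V) :
    IsMaximalPair G (perpL G B) (perpR G (perpL G B)) :=
  ⟨rfl, (subset_perpL_iff.2 subset_rfl).antisymm (perpL_anti (subset_perpL_iff.1 subset_rfl))⟩

/-- Any strict inclusion of maximal pairs is overlapping: the first component of the larger one
meets the second component of the smaller one. -/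
def IsOverlapping (G : Digraph V) : Prop :=
  ∀ ⦃X Y X' Y' : Set V⦄, IsMaximalPair G X Y → IsMaximalPair G X' Y' → X ⊆ X' →
    Disjoint X' Y → X = X'

theorem isOverlapping_of_not_exists
    (h : ¬ ∃ X₁ X₂ X₃ X₄ Z : Set V, IsFiveSetPartition G X₁ X₂ X₃ X₄ Z) : IsOverlapping G := by
  intro X Y X' Y' hXY hXY' hsub hdis
  by_contra hne
  apply h
  have hY : Y' ⊆ Y := by rw [hXY.right_eq, hXY'.right_eq]; exact perpR_anti hsub
  have mX : ∀ {v}, v ∈ X ↔ v ∉ Y ∧ ∀ b ∈ Y, ¬ G.Adj v b := fun {v} => by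
    conv_lhs => rw [hXY.left_eq]
    rfl
  have mX' : ∀ {v}, v ∈ X' ↔ v ∉ Y' ∧ ∀ b ∈ Y', ¬ G.Adj v b := fun {v} => by
    conv_lhs => rw [hXY'.left_eq]
    rfl
  have mY : ∀ {v}, v ∈ Y ↔ v ∉ X ∧ ∀ b ∈ X, ¬ G.Adj b v := fun {v} => by
    conv_lhs => rw [hXY.right_eq]
    rfl
  have mY' : ∀ {v}, v ∈ Y' ↔ v ∉ X' ∧ ∀ b ∈ X', ¬ G.Adj b v := fun {v} => by
    conv_lhs => rw [hXY'.right_eq]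
    rfl
  have hXd : ∀ {v}, v ∈ X' → v ∉ Y := fun h => Set.disjoint_left.1 hdis h
  have e3 : ∀ x ∈ X' \ X, (∃ y ∈ X, G.Adj y x) ∧ ∃ y ∈ Y \ Y', G.Adj x y := by
    rintro x ⟨hx, hxX⟩
    constructor
    · by_contra! hn
      exact hXd hx (mY.2 ⟨hxX, hn⟩)
    · by_contra! hn
      refine hxX (mX.2 ⟨hXd hx, fun b hb hxb => ?_⟩)
      by_cases hb' : b ∈ Y'
      · exact (mX'.1 hx).2 b hb' hxb
      · exact hn b ⟨hb, hb'⟩ hxb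
  have e2 : ∀ x ∈ Y \ Y', (∃ y ∈ Y', G.Adj x y) ∧ ∃ y ∈ X' \ X, G.Adj y x := by
    rintro x ⟨hx, hxY⟩
    have hxX : x ∉ X' := fun h => hXd h hx
    constructor
    · by_contra! hn
      exact hxX (mX'.2 ⟨hxY, hn⟩)
    · by_contra! hn
      refine hxY (mY'.2 ⟨hxX, fun b hb hxb => ?_⟩)
      by_cases hb' : b ∈ X
      · exact (mY.1 hx).2 b hb' hxb
      · exact hn b ⟨hb, hb'⟩ hxb
  obtain ⟨c, hc⟩ : (X' \ X).Nonempty := by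
    rw [Set.nonempty_iff_ne_empty]
    exact fun e => hne (hsub.antisymm (Set.sdiff_eq_empty.1 e))
  obtain ⟨⟨d, hd, -⟩, b, hb, -⟩ := e3 c hc
  obtain ⟨⟨a, ha, -⟩, -⟩ := e2 b hb
  -- The required edges express maximality: a vertex lacking one could be added to a component of
  -- one of the two pairs.
  refine ⟨Y', Y \ Y', X' \ X, X, {v | v ∉ Y ∧ v ∉ X'}, ?_, ?_, ⟨a, ha⟩, ⟨b, hb⟩, ⟨c, hc⟩, ⟨d, hd⟩,
    e3, e2, ?_, ?_, ?_, ?_⟩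
  · simp only [List.pairwise_cons, List.mem_cons, List.not_mem_nil, or_false, forall_eq_or_imp,
      forall_eq, Set.disjoint_left, Set.mem_sdiff, Set.mem_ofPred_eq, List.Pairwise.nil, and_true,
      IsEmpty.forall_iff, implies_true]
    refine ⟨⟨?_, ?_, ?_, ?_⟩, ⟨?_, ?_, ?_⟩, ⟨?_, ?_⟩, ?_⟩
    · exact fun v h h' => h'.2 h
    · exact fun v h h' => hXd h'.1 (hY h)
    · exact fun v h h' => hXd (hsub h') (hY h)
    · exact fun v h h' => h'.1 (hY h)
    · exact fun v h h' => hXd h'.1 h.1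
    · exact fun v h h' => hXd (hsub h') h.1
    · exact fun v h h' => h'.1 h.1
    · exact fun v h h' => h.2 h'
    · exact fun v h h' => h'.2 h.1
    · exact fun v h h' => h'.2 (hsub h)
  · ext v
    simp only [Set.mem_union, Set.mem_sdiff, Set.mem_ofPred_eq, Set.mem_univ, iff_true]
    tauto
  · exact fun x hx y hy => (mX.1 hx).2 y hy.1
  · exact fun x hx y hy => (mX.1 hx).2 y (hY hy)
  · exact fun x hx y hy => (mX'.1 hx.1).2 y hy
  · rintro z ⟨hz, hz'⟩
    constructor
    · by_contra! hn
      exact hz (mY.2 ⟨fun h => hz' (hsub h), hn⟩)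
    · by_contra! hn
      exact hz' (mX'.2 ⟨fun h => hz (hY h), hn⟩)

namespace TightPair

/-- The first component of the maximal pair of a tight pair. -/
def left (x : TightPair G) : Set V := perpL G x.up

/-- The second component of the maximal pair of a tight pair. -/
def right (x : TightPair G) : Set V := perpR G x.down

theorem down_subset_left (x : TightPair G) : x.down ⊆ x.left :=
  fun _ ha => ⟨x.notMem_up ha, fun _ hu => x.not_adj ha hu⟩

theorem up_subset_right (x : TightPair G) : x.up ⊆ x.right :=
  fun _ ha => ⟨x.notMem_down ha, fun _ hd => x.not_adj hd ha⟩

theorem disjoint_left_right (hr : IsRank G r) (x : TightPair G) : Disjoint x.left x.right := by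
  rw [Set.disjoint_left]
  intro a h h'
  rcases x.exists_adj hr h'.1 h.1 with ⟨d, hd, hda⟩ | ⟨u, hu, hau⟩
  · exact h'.2 d hd hda
  · exact h.2 u hu hau

/-- The closures of `x.down` and of `x.up` are nested maximal pairs, and tightness makes `x.left`
and `x.right` disjoint, so overlapping forces the closures to agree. -/
theorem isMaximalPair (hr : IsRank G r) (hO : IsOverlapping G) (x : TightPair G) :
    IsMaximalPair G x.left x.right := by
  have e : perpL G x.right = x.left :=
    hO (isMaximalPair_closure x.down) (isMaximalPair_closure' x.up) (perpL_anti x.up_subset_right)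
      (x.disjoint_left_right hr)
  have := isMaximalPair_closure (G := G) x.down
  rwa [← right, e] at this

end TightPair

/-! ### The flip order as inclusion of maximal pairs. -/

section Overlapping

/-- `U` is a kernel of `Y` and `D` a kernel of `X` for reversed edges. Absorption supplies the
disjointness needed for overlapping to identify both closures with the given pair. -/
theorem exists_left_eq (hr : IsRank G r) (hl : IsLinearExtension G l)
    (hl' : IsReverseLinearExtension G l') (hO : IsOverlapping G) {X Y : Set V}
    (h : IsMaximalPair G X Y) : ∃ x : TightPair G, x.left = X ∧ x.right = Y := by
  obtain ⟨U, hU, hUi, hUc⟩ := exists_kernel hr hl Y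
  obtain ⟨D, hD, hDi, hDc⟩ := exists_kernel hr.op hl'.op X
  have e1 : perpL G (perpR G D) = X := by
    refine hO (isMaximalPair_closure D) h ?_ ?_
    · rw [h.left_eq, h.right_eq]
      exact perpL_anti (perpR_anti hD)
    · refine Set.disjoint_left.2 fun k hk hk' => ?_
      obtain ⟨d, hd, hdk⟩ := hDc k hk hk'.1
      exact hk'.2 d hd hdk
  have e2 : perpR G D = Y := by
    rw [(isMaximalPair_closure D).right_eq, e1, h.right_eq]
  have e3 : X = perpL G U := by
    refine hO h (isMaximalPair_closure' U) ?_ ?_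
    · rw [h.left_eq]
      exact perpL_anti hU
    · refine Set.disjoint_left.2 fun k hk hk' => ?_
      obtain ⟨d, hd, hdk⟩ := hUc k hk' hk.1
      exact hk.2 d hd hdk
  have hDU : ∀ d ∈ D, d ∈ perpL G U := fun d hd => e3 ▸ hD hd
  refine ⟨⟨(D, U), (isTightPair_iff hr).2 ⟨⟨fun a ha b hb => hDi b hb a ha, hUi,
    Set.disjoint_left.2 fun d hd => (hDU d hd).1, fun d hd => (hDU d hd).2⟩, ?_⟩⟩, e3.symm, e2⟩
  intro k hkD hkU
  by_contra! hk
  have hkX : k ∈ X := e3 ▸ ⟨hkU, hk.2⟩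
  obtain ⟨d, hd, hdk⟩ := hDc k hkX hkD
  exact hk.1 d hd hdk

variable [Finite V]

theorem exists_isFlip_left (hr : IsRank G r) (hl : IsLinearExtension G l)
    (hl' : IsReverseLinearExtension G l') (hO : IsOverlapping G) (x : TightPair G) {g : V}
    (hg : g ∈ x.up) : ∃ y, IsFlip G g x y ∧ y.left = perpL G (perpR G (insert g x.left)) := by
  obtain ⟨y, hyX, hyY⟩ := exists_left_eq hr hl hl' hO (isMaximalPair_closure (insert g x.left))
  have hx := x.isMaximalPair hr hO
  have hy := y.isMaximalPair hr hO
  have mY : ∀ {k}, k ∈ y.right ↔ k ∈ x.right ∧ k ≠ g ∧ ¬ G.Adj g k := by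
    intro k
    rw [hyY, hx.right_eq]
    simp only [perpR, Set.mem_insert_iff, Set.mem_ofPred_eq, forall_eq_or_imp]
    tauto
  have hsub : insert g x.left ⊆ y.left := by
    rw [hyX]
    exact subset_perpL_iff.2 subset_rfl
  have hgy : g ∈ y.left := hsub (.inl rfl)
  have hxy : x.left ⊆ y.left := fun k hk => hsub (.inr hk)
  have hyR : ∀ {k}, k ∈ y.left → ∀ b ∈ y.right, ¬ G.Adj k b := by
    intro k hk
    rw [hy.left_eq] at hk
    exact hk.2
  -- Any other such `k` has an edge from `g`, so it is not in `x.up` and by tightness has an edge to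
  -- some `u ∈ x.up`. This `u` remains in `y.right`, contradicting `k ∈ y.left`.
  have hmeet : ∀ {k}, k ∈ y.left → k ∈ x.right → k = g := by
    intro k hk hk'
    by_contra hkg
    have hgk : G.Adj g k := by
      by_contra hgk
      exact Set.disjoint_left.1 (y.disjoint_left_right hr) hk (mY.2 ⟨hk', hkg, hgk⟩)
    have hkU : k ∉ x.up := fun h => x.not_adj_up hg h hgk
    rcases x.exists_adj hr hk'.1 hkU with ⟨d, hd, hdk⟩ | ⟨u, hu, hku⟩
    · exact hk'.2 d hd hdk
    · refine hyR hk u (mY.2 ⟨x.up_subset_right hu, ?_, x.not_adj_up hg hu⟩) hku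
      rintro rfl
      exact hr.not_adj (hr.lt_of_adj hku).le hgk
  have hU : ∀ k, ¬ GLE G g k → (k ∈ x.up ↔ k ∈ y.up) := by
    intro k
    induction k using (IsRank.wellFounded r).induction with
    | _ k ih =>
    intro hgk
    have ih' : ∀ u, G.Adj k u → (u ∈ x.up ↔ u ∈ y.up) := fun u hu =>
      ih u (hr.lt_of_adj hu) fun h => hgk (h.trans (.of_adj hu))
    constructor
    · intro hk
      have hkY : k ∈ y.right := mY.2 ⟨x.up_subset_right hk, fun e => hgk (e ▸ .refl),
        x.not_adj_up hg hk⟩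
      by_contra hky
      rcases y.exists_adj hr hkY.1 hky with ⟨d, hd, hdk⟩ | ⟨u, hu, hku⟩
      · exact hkY.2 d hd hdk
      · exact x.not_adj_up hk ((ih' u hku).2 hu) hku
    · intro hk
      have hkY : k ∈ x.right := (mY.1 (y.up_subset_right hk)).1
      by_contra hkx
      rcases x.exists_adj hr hkY.1 hkx with ⟨d, hd, hdk⟩ | ⟨u, hu, hku⟩
      · exact hkY.2 d hd hdk
      · exact y.not_adj_up hk ((ih' u hku).1 hu) hku
  have hD : ∀ k, ¬ GLE G k g → (k ∈ x.down ↔ k ∈ y.down) := by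
    intro k
    induction k using (IsRank.wellFounded fun v => -r v).induction with
    | _ k ih =>
    intro hkg
    have ih' : ∀ d, G.Adj d k → (d ∈ x.down ↔ d ∈ y.down) := fun d hd =>
      ih d (neg_lt_neg (hr.lt_of_adj hd)) fun h => hkg ((GLE.of_adj hd).trans h)
    constructor
    · intro hk
      have hkX := hxy (x.down_subset_left hk)
      by_contra hky
      rcases y.exists_adj hr hky hkX.1 with ⟨d, hd, hdk⟩ | ⟨u, hu, hku⟩
      · exact x.not_adj_down ((ih' d hdk).2 hd) hk hdk
      · exact hkX.2 u hu hku
    · intro hk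
      by_contra hkx
      refine hkg (hmeet (y.down_subset_left hk) ⟨hkx, fun d hd hdk => ?_⟩ ▸ .refl)
      exact y.not_adj_down ((ih' d hdk).1 hd) hk hdk
  refine ⟨y, ⟨hg, ?_, fun {k} => hD k, fun {k} => hU k⟩, hyX⟩
  by_contra hgD
  rcases y.exists_adj hr hgD hgy.1 with ⟨d, hd, hdg⟩ | ⟨u, hu, hgu⟩
  · exact x.not_adj ((hD d (hr.not_gle (hr.lt_of_adj hdg))).2 hd) hg hdg
  · exact hgy.2 u hu hgu

/-- The sets `U` are compared by induction on rank: a vertex of `x.up` missing from `z.up` would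
have no edge to `z.up`, hence lie in `z.left`. -/
theorem eq_of_left_subset (hr : IsRank G r) (hO : IsOverlapping G) {x z : TightPair G}
    (h : x.left ⊆ z.left) (hd : Disjoint x.up z.left) : x = z := by
  have hY : z.right ⊆ x.right := by
    rw [(x.isMaximalPair hr hO).right_eq, (z.isMaximalPair hr hO).right_eq]
    exact perpR_anti h
  refine eq_of_up_eq hr (Set.ext fun k => ?_)
  induction k using (IsRank.wellFounded r).induction with
  | _ k ih =>
  constructor
  · intro hk
    by_contra hkz
    refine Set.disjoint_left.1 hd hk ⟨hkz, fun u hu hku => ?_⟩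
    exact x.not_adj_up hk ((ih u (hr.lt_of_adj hku)).2 hu) hku
  · intro hk
    have hkY := hY (z.up_subset_right hk)
    by_contra hkx
    rcases x.exists_adj hr hkY.1 hkx with ⟨d, hd, hdk⟩ | ⟨u, hu, hku⟩
    · exact hkY.2 d hd hdk
    · exact z.not_adj_up hk ((ih u (hr.lt_of_adj hku)).1 hu) hku

theorem flipLE_iff_left_subset (hr : IsRank G r) (hl : IsLinearExtension G l)
    (hl' : IsReverseLinearExtension G l') (hO : IsOverlapping G) {x z : TightPair G} :
    FlipLE G x z ↔ x.left ⊆ z.left := by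
  constructor
  · intro h
    induction h with
    | refl => exact subset_rfl
    | @tail y z _ h ih =>
      obtain ⟨g, hg⟩ := h
      obtain ⟨w, hw, hwX⟩ := exists_isFlip_left hr hl hl' hO y hg.mem_up
      rw [hg.unique hr hw, hwX]
      exact (ih.trans (Set.subset_insert _ _)).trans (subset_perpL_iff.2 subset_rfl)
  · induction x using (flip_wellFounded_swap hr).induction with
    | _ x ih =>
    intro h
    -- If `g` lies in both sets, flipping `x` at `g` yields the closure of `insert g x.left`, which
    -- is still inside the closed set `z.left`.
    by_cases hd : Disjoint x.up z.left
    · exact eq_of_left_subset hr hO h hd ▸ .refl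
    · obtain ⟨g, hg, hgz⟩ := Set.not_disjoint_iff.1 hd
      obtain ⟨y, hy, hyX⟩ := exists_isFlip_left hr hl hl' hO x hg
      refine hy.flipLE.trans (ih y (hy.flipLE_and_ne hr) ?_)
      have hz := z.isMaximalPair hr hO
      rw [hyX, hz.left_eq, hz.right_eq]
      exact perpL_anti (perpR_anti (Set.insert_subset hgz h))

theorem isLatticeOrder_of_isOverlapping (hr : IsRank G r) (hl : IsLinearExtension G l)
    (hl' : IsReverseLinearExtension G l') (hO : IsOverlapping G) : IsLatticeOrder (FlipLE G) := by
  choose cl hcl using fun A : Set V =>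
    exists_left_eq hr hl hl' hO (isMaximalPair_closure (G := G) A)
  have hcl_le : ∀ {A : Set V} {z : TightPair G}, (cl A).left ⊆ z.left ↔ A ⊆ z.left := by
    intro A z
    have hz := z.isMaximalPair hr hO
    rw [(hcl A).1]
    refine ⟨fun h => (subset_perpL_iff.2 subset_rfl).trans h, fun h => ?_⟩
    rw [hz.left_eq, hz.right_eq]
    exact perpL_anti (perpR_anti h)
  have hle_cl : ∀ {A : Set V}, A ⊆ (cl A).left := fun {A} => hcl_le.1 subset_rfl
  refine ⟨{
    le := fun x y => x.left ⊆ y.left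
    le_refl := fun x => subset_rfl
    le_trans := fun x y z h h' => Set.Subset.trans h h'
    le_antisymm := fun x y h h' => FlipLE.antisymm hr
      ((flipLE_iff_left_subset hr hl hl' hO).2 h) ((flipLE_iff_left_subset hr hl hl' hO).2 h')
    sup := fun x y => cl (x.left ∪ y.left)
    le_sup_left := fun x y => Set.subset_union_left.trans hle_cl
    le_sup_right := fun x y => Set.subset_union_right.trans hle_cl
    sup_le := fun x y z h h' => hcl_le.2 (Set.union_subset h h')
    inf := fun x y => cl (x.left ∩ y.left)
    inf_le_left := fun x y => hcl_le.2 Set.inter_subset_left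
    inf_le_right := fun x y => hcl_le.2 Set.inter_subset_right
    le_inf := fun x y z h h' => Set.Subset.trans (Set.subset_inter h h') hle_cl },
    fun x y => (flipLE_iff_left_subset hr hl hl' hO).symm⟩

end Overlapping

end IndepPoset

theorem mainTheorem5 {V : Type*} [Finite V] (G : Digraph V) (hG : IndepPoset.IsAcyclic G)
    (l l' : List V) (hl : IndepPoset.IsLinearExtension G l)
    (hl' : IndepPoset.IsReverseLinearExtension G l') :
    IndepPoset.IsLatticeOrder (IndepPoset.IndepLE G l l') ↔
      ¬ ∃ X₁ X₂ X₃ X₄ Z : Set V, IndepPoset.IsFiveSetPartition G X₁ X₂ X₃ X₄ Z := by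
  obtain ⟨r, hr⟩ := hl.exists_isRank hG
  rw [IndepPoset.indepLE_eq_flipLE hr hl hl']
  constructor
  · rintro ⟨L, hL⟩ ⟨X₁, X₂, X₃, X₄, Z, h⟩
    exact IndepPoset.not_isFiveSetPartition_of_lattice hr hl hl' hL h
  · exact fun h => IndepPoset.isLatticeOrder_of_isOverlapping hr hl hl'
      (IndepPoset.isOverlapping_of_not_exists h)
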